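/- Let $\Omega$ be a locally compact Hausdorff space and $G$ a group. Let $C_0(\Omega)$ be the real Banach lattice of real-valued continuous functions on $\Omega$ vanishing at infinity (pointwise order, supremum norm), and let $\mathrm{Aut}^+(C_0(\Omega))$ be its group of lattice automorphisms, i.e. linear bijections preserving the lattice operations, equipped with the strong operator topology. A positive representation of $G$ in $C_0(\Omega)$ is a group homomorphism $\rho\colon G\to\mathrm{Aut}^+(C_0(\Omega))$, $s\mapsto\rho_s$. It has compact image if $\rho(G)$ is compact in the strong operator topology, and, if $G$ carries a topology, it is strongly continuous if it is continuous for the strong operator topology. View $\phi$ in the group $\mathrm{Homeo}(\Omega)$ of homeomorphisms of $\Omega$ as the isometric lattice automorphism $x\mapsto x\circ\phi^{-1}$, so that a homomorphism $\pi\colon G\to\mathrm{Homeo}(\Omega)$ is an isometric positive representation. Let $C_b(\Omega)^{++}$ be the set of bounded continuous $m\colon\Omega\to\mathbb R$ for which there is $\delta>0$ with $m(\omega)\ge\delta$ for all $\omega\in\Omega$, and view $m\in C_b(\Omega)^{++}$ as the lattice automorphism $x\mapsto mx$. Two positive representations $\rho^1,\rho^2$ of $G$ in $C_0(\Omega)$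 are order equivalent if there is $T\in\mathrm{Aut}^+(C_0(\Omega))$ with $T\rho^1_s=\rho^2_sT$ for all $s\in G$, and isometrically order equivalent if $T$ can be chosen isometric. (1) If $\rho\colon G\to\mathrm{Aut}^+(C_0(\Omega))$ is a positive representation with compact image, then there exist a unique homomorphism $\pi\colon G\to\mathrm{Homeo}(\Omega)$ and an $m\in C_b(\Omega)^{++}$ such that \[ \rho_s = m\,\pi_s\,m^{-1}\qquad\text{for all } s\in G, \] and the image of $\pi$ is compact. (2) Conversely, for every homomorphism $\pi\colon G\to\mathrm{Homeo}(\Omega)$ with compact image and every $m\in C_b(\Omega)^{++}$, the above equation defines a positive representation $\rho$ with compact image. (3) If $G$ carries a topology and $\rho$ is a positive representation with compact image such that $\rho_s = m\pi_s m^{-1}$ for all $s\in G$, with $\pi$ and $m$ as above, then $\rho$ is strongly continuous if and only if $\pi$ is strongly continuous. (4) If $\rho^1=m_1\pi^1m_1^{-1}$ and $\rho^2=m_2\pi^2m_2^{-1}$ are positive representations with compact image, where $\pi^1,\pi^2\colon G\to\mathrm{Homeo}(\Omega)$ are homomorphisms with compact image and $m_1,m_2\in C_b(\Omega)^{++}$,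 then $\rho^1$ and $\rho^2$ are order equivalent if and only if $\pi^1$ and $\pi^2$ are isometrically order equivalent. -/

import Mathlib

open Set Filter Topology
open scoped ZeroAtInfty BoundedContinuousFunction

namespace PosRep

noncomputable section

/-! Lattice automorphisms and positive representations in a real Banach lattice -/

section BanachLattice

variable (E : Type*) [NormedAddCommGroup E] [NormedSpace ℝ E] [Lattice E]

/-- The group `Aut⁺(E)` of lattice automorphisms of `E`: the linear bijections that preserve the
lattice operations. On a Banach lattice they are automatically bounded. -/
def latticeAut : Subgroup (E ≃ₗ[ℝ] E) where
  carrier := {T | ∀ x y : E, T (x ⊔ y) = T x ⊔ T y ∧ T (x ⊓ y) = T x ⊓ T y}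
  one_mem' := fun _ _ => ⟨rfl, rfl⟩
  mul_mem' := by
    intro S T hS hT x y
    simp only [LinearEquiv.mul_apply, (hT x y).1, (hT x y).2]
    exact hS (T x) (T y)
  inv_mem' := by
    intro T hT x y
    have h := hT (T.symm x) (T.symm y)
    simp only [LinearEquiv.apply_symm_apply] at h
    change T.symm (x ⊔ y) = T.symm x ⊔ T.symm y ∧ T.symm (x ⊓ y) = T.symm x ⊓ T.symm y
    rw [LinearEquiv.symm_apply_eq, LinearEquiv.symm_apply_eq, h.1, h.2]
    exact ⟨rfl, rfl⟩

/-- The strong operator topology on `Aut⁺(E)`: the coarsest topology for which all the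
evaluations `T ↦ T x`, `x ∈ E`, are norm continuous. -/
instance strongOperatorTopology : TopologicalSpace (latticeAut E) :=
  TopologicalSpace.induced (fun (T : latticeAut E) (x : E) => (T : E ≃ₗ[ℝ] E) x) inferInstance

/-- The subgroup `IAut⁺(E)` of isometric lattice automorphisms. -/
def isometricLatticeAut : Subgroup (latticeAut E) where
  carrier := {T | ∀ x : E, ‖(T : E ≃ₗ[ℝ] E) x‖ = ‖x‖}
  one_mem' := fun _ => rfl
  mul_mem' := by
    intro S T hS hT x
    exact (hS _).trans (hT x)
  inv_mem' := by
    intro T hT x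
    have h := hT ((T : E ≃ₗ[ℝ] E).symm x)
    rw [LinearEquiv.apply_symm_apply] at h
    exact h.symm

variable {E} {G : Type*} [Group G]

/-- The image of a positive representation is compact in the strong operator topology. -/
def HasCompactImage (ρ : G →* latticeAut E) : Prop := IsCompact (Set.range ρ)

/-- Order equivalence of positive representations in `E`: some lattice automorphism (which is
automatically a positive operator) intertwines them. -/
def OrderEquivalent (ρ θ : G →* latticeAut E) : Prop :=
  ∃ T : latticeAut E, ∀ s : G, T * ρ s = θ s * T

/-- Isometric order equivalence: some isometric lattice automorphism intertwines them. -/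
def IsometricallyOrderEquivalent (ρ θ : G →* latticeAut E) : Prop :=
  ∃ T ∈ isometricLatticeAut E, ∀ s : G, T * ρ s = θ s * T

end BanachLattice

/-! The Banach lattice `C₀(Ω)` -/

section COO

variable {Ω : Type*} [TopologicalSpace Ω]

/-- Pointwise order. -/
instance : LE C₀(Ω, ℝ) := ⟨fun x y => ∀ ω, x ω ≤ y ω⟩

instance : LT C₀(Ω, ℝ) := ⟨fun x y => (fun ω => x ω) < (fun ω => y ω)⟩

/-- Pointwise maximum. -/
instance : Max C₀(Ω, ℝ) :=
  ⟨fun x y =>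
    { toFun := fun ω => max (x ω) (y ω)
      continuous_toFun := x.continuous.max y.continuous
      zero_at_infty' := by
        simpa using (zero_at_infty x).max (zero_at_infty y) }⟩

/-- Pointwise minimum. -/
instance : Min C₀(Ω, ℝ) :=
  ⟨fun x y =>
    { toFun := fun ω => min (x ω) (y ω)
      continuous_toFun := x.continuous.min y.continuous
      zero_at_infty' := by
        simpa using (zero_at_infty x).min (zero_at_infty y) }⟩

instance : Lattice C₀(Ω, ℝ) :=
  Function.Injective.lattice (fun (x : C₀(Ω, ℝ)) (ω : Ω) => x ω) DFunLike.coe_injective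
    Iff.rfl Iff.rfl (fun _ _ => rfl) (fun _ _ => rfl)

/-- With these operations and the supremum norm, `C₀(Ω)` is a Banach lattice. -/
instance : IsOrderedAddMonoid C₀(Ω, ℝ) where
  add_le_add_left _ _ h z ω := add_le_add_left (h ω) (z ω)

instance : HasSolidNorm C₀(Ω, ℝ) where
  solid x y h := by
    have habs : ∀ (z : C₀(Ω, ℝ)) (ω : Ω), |z| ω = ‖z ω‖ := fun _ _ => rfl
    rw [← ZeroAtInftyContinuousMap.norm_toBCF_eq_norm,
      ← ZeroAtInftyContinuousMap.norm_toBCF_eq_norm]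
    refine (BoundedContinuousFunction.norm_le (norm_nonneg _)).2 fun ω => ?_
    refine le_trans ?_ (y.toBCF.norm_coe_le_norm ω)
    have := h ω
    rwa [habs, habs] at this

/-- The operator `x ↦ x ∘ φ⁻¹` of a homeomorphism `φ`. -/
def homeoLinearEquiv (φ : Ω ≃ₜ Ω) : C₀(Ω, ℝ) ≃ₗ[ℝ] C₀(Ω, ℝ) where
  toFun x := ⟨⟨fun ω => x (φ.symm ω), x.continuous.comp φ.symm.continuous⟩,
    (zero_at_infty x).comp φ.symm.isClosedEmbedding.tendsto_cocompact⟩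
  invFun x := ⟨⟨fun ω => x (φ ω), x.continuous.comp φ.continuous⟩,
    (zero_at_infty x).comp φ.isClosedEmbedding.tendsto_cocompact⟩
  map_add' _ _ := rfl
  map_smul' _ _ := rfl
  left_inv x := by ext ω; exact congrArg x (φ.symm_apply_apply ω)
  right_inv x := by ext ω; exact congrArg x (φ.apply_symm_apply ω)

/-- `Homeo(Ω)` acting on `C₀(Ω)` by lattice automorphisms, `φ x = x ∘ φ⁻¹`. -/
def homeoAut : (Ω ≃ₜ Ω) →* latticeAut C₀(Ω, ℝ) where
  toFun φ := ⟨homeoLinearEquiv φ, fun _ _ => ⟨rfl, rfl⟩⟩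
  map_one' := rfl
  map_mul' _ _ := rfl

theorem homeoAut_isometric (φ : Ω ≃ₜ Ω) : homeoAut φ ∈ isometricLatticeAut C₀(Ω, ℝ) := by
  have key : ∀ (ψ : Ω ≃ₜ Ω) (x : C₀(Ω, ℝ)), ‖homeoLinearEquiv ψ x‖ ≤ ‖x‖ := by
    intro ψ x
    rw [← ZeroAtInftyContinuousMap.norm_toBCF_eq_norm,
      ← ZeroAtInftyContinuousMap.norm_toBCF_eq_norm]
    exact (BoundedContinuousFunction.norm_le (norm_nonneg _)).2
      fun ω => x.toBCF.norm_coe_le_norm (ψ.symm ω)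
  intro x
  refine le_antisymm (key φ x) ?_
  have h := key φ.symm (homeoLinearEquiv φ x)
  rwa [show homeoLinearEquiv φ.symm (homeoLinearEquiv φ x) = x from
    (homeoLinearEquiv φ).symm_apply_apply x] at h

/-- The isometric positive representation on `C₀(Ω)` given by a homomorphism `π : G → Homeo(Ω)`. -/
def homeoRep {G : Type*} [Group G] (π : G →* (Ω ≃ₜ Ω)) : G →* latticeAut C₀(Ω, ℝ) :=
  homeoAut.comp π

variable (Ω) in
/-- `C_b(Ω)⁺⁺`: the bounded continuous functions that are bounded below by some `δ > 0`. -/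
def CbPos : Type _ := {m : Ω →ᵇ ℝ // ∃ δ : ℝ, 0 < δ ∧ ∀ ω, δ ≤ m ω}

theorem CbPos.pos (m : CbPos Ω) (ω : Ω) : 0 < m.1 ω := by
  obtain ⟨δ, hδ, h⟩ := m.2
  exact hδ.trans_le (h ω)

/-- The pointwise inverse of `m ∈ C_b(Ω)⁺⁺`, as a bounded continuous function. -/
def CbPos.recip (m : CbPos Ω) : Ω →ᵇ ℝ where
  toFun ω := (m.1 ω)⁻¹
  continuous_toFun := m.1.continuous.inv₀ fun ω => (m.pos ω).ne'
  map_bounded' := by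
    obtain ⟨δ, hδ, h⟩ := m.2
    refine ⟨2 * δ⁻¹, BoundedContinuousFunction.dist_le_two_norm' fun ω => ?_⟩
    rw [Real.norm_of_nonneg (inv_nonneg.2 (m.pos ω).le)]
    exact inv_anti₀ hδ (h ω)

/-- Pointwise multiplication of `x ∈ C₀(Ω)` by a bounded continuous function `m`. -/
def mulFun (m : Ω →ᵇ ℝ) (x : C₀(Ω, ℝ)) : C₀(Ω, ℝ) where
  toFun ω := m ω * x ω
  continuous_toFun := m.continuous.mul x.continuous
  zero_at_infty' := by
    refine squeeze_zero_norm (a := fun ω => ‖m‖ * ‖x ω‖) (fun ω => ?_) ?_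
    · rw [norm_mul]
      exact mul_le_mul_of_nonneg_right (m.norm_coe_le_norm ω) (norm_nonneg _)
    · simpa using (zero_at_infty x).norm.const_mul ‖m‖

/-- The multiplication operator by `m ∈ C_b(Ω)⁺⁺` as a linear bijection of `C₀(Ω)`. -/
def mulLinearEquiv (m : CbPos Ω) : C₀(Ω, ℝ) ≃ₗ[ℝ] C₀(Ω, ℝ) where
  toFun := mulFun m.1
  invFun := mulFun m.recip
  map_add' x y := by
    ext ω
    exact mul_add (m.1 ω) (x ω) (y ω)
  map_smul' c x := by
    ext ω
    exact mul_left_comm (m.1 ω) c (x ω)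
  left_inv x := by
    ext ω
    exact inv_mul_cancel_left₀ (m.pos ω).ne' (x ω)
  right_inv x := by
    ext ω
    exact mul_inv_cancel_left₀ (m.pos ω).ne' (x ω)

/-- An element `m` of `C_b(Ω)⁺⁺` viewed as a lattice automorphism of `C₀(Ω)`, namely the
operator of multiplication by `m`. -/
def mulAut (m : CbPos Ω) : latticeAut C₀(Ω, ℝ) :=
  ⟨mulLinearEquiv m, fun x y =>
    ⟨by ext ω; exact mul_max_of_nonneg (x ω) (y ω) (m.pos ω).le,
     by ext ω; exact mul_min_of_nonneg (x ω) (y ω) (m.pos ω).le⟩⟩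

end COO

end

end PosRep

open PosRep

/-! For a lattice automorphism `T`, each functional `x ↦ T x ω` is a nonzero lattice homomorphism
into `ℝ`, hence a positive multiple of a point evaluation (`exists_eq_weighted_eval`). So `T x = h ·
(x ∘ φ⁻¹)` with a weight `h > 0` and a homeomorphism `φ`. The map `T ↦ φ` is a group homomorphism,
`underlyingHomeo`, which sends multiplication operators to `1` and restricts to the identity on
`Homeo(Ω)`. This gives the uniqueness of `π`, and it turns an order equivalence of `π₁` and `π₂`
into an isometric one.

For existence, the weights of `ρ` satisfy a cocycle identity (`weight_mul`). Their supremum over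
`G`, the function `m` of `exists_eq_conj`, satisfies `m = h_s · (m ∘ φ_s⁻¹)`, which is the
conjugation formula. Compactness of the image makes this supremum bounded (`exists_weight_le`) and
continuous (`continuous_weight`).

The other claims hold because conjugation by a fixed automorphism is continuous for the strong
operator topology. -/

namespace PosRep

noncomputable section

/-! ### Lattice homomorphisms from `C₀(Ω)` to `ℝ` -/

section Evaluation

variable {Ω : Type*} [TopologicalSpace Ω]

/-- The pointwise square root. -/
def sqrtFun (x : C₀(Ω, ℝ)) : C₀(Ω, ℝ) where
  toFun ω := √(x ω)
  continuous_toFun := x.continuous.sqrt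
  zero_at_infty' := by simpa using (zero_at_infty x).sqrt

theorem C0_norm_apply_le (x : C₀(Ω, ℝ)) (ω : Ω) : ‖x ω‖ ≤ ‖x‖ := by
  rw [← ZeroAtInftyContinuousMap.norm_toBCF_eq_norm]
  exact x.toBCF.norm_coe_le_norm ω

theorem C0_norm_le {x : C₀(Ω, ℝ)} {C : ℝ} (hC : 0 ≤ C) (h : ∀ ω, ‖x ω‖ ≤ C) : ‖x‖ ≤ C := by
  rw [← ZeroAtInftyContinuousMap.norm_toBCF_eq_norm]
  exact (BoundedContinuousFunction.norm_le hC).2 h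

theorem C0_continuous_eval : Continuous fun p : C₀(Ω, ℝ) × Ω => p.1 p.2 := by
  have h : Continuous fun p : C₀(Ω, ℝ) × Ω => p.1.toBCF p.2 :=
    continuous_eval.comp
      ((ZeroAtInftyContinuousMap.isometry_toBCF.continuous.comp continuous_fst).prodMk
        continuous_snd)
  exact h

/-- The non-negative functions annihilated by a nonzero positive functional on `C₀(Ω)` have a
common zero. -/
theorem exists_common_zero (f : C₀(Ω, ℝ) →ₗ[ℝ] ℝ) (hf : ∀ x, 0 ≤ x → 0 ≤ f x)
    {u : C₀(Ω, ℝ)} (hu : 0 ≤ u) (hfu : f u = 1) :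
    ∃ ω, ∀ y : C₀(Ω, ℝ), 0 ≤ y → f y = 0 → y ω = 0 := by
  by_contra! hcon
  -- The contradiction will be `u ≤ y + ε√u` with `f y = 0`, whence `1 = f u ≤ ε f(√u) < 1`. The
  -- function `√u` replaces a constant, which need not lie in `C₀(Ω)`: where `u < ε²`, already `u ≤
  -- ε√u`.
  obtain ⟨ε, hε, hε1⟩ : ∃ ε : ℝ, 0 < ε ∧ ε * f (sqrtFun u) < 1 := by
    have h0 : 0 ≤ f (sqrtFun u) := hf _ fun ω => Real.sqrt_nonneg _
    refine ⟨(f (sqrtFun u) + 1)⁻¹, by positivity, ?_⟩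
    rw [inv_mul_lt_iff₀ (by positivity)]
    linarith
  have hev : ∀ᶠ ω in cocompact Ω, u ω < ε ^ 2 :=
    (zero_at_infty u).eventually (gt_mem_nhds (by positivity))
  obtain ⟨K, hK, hKu⟩ := mem_cocompact.1 hev
  -- By compactness, finitely many multiples of annihilated functions, positive at the points of
  -- `K`, add up to a function dominating `u` on `K`.
  obtain ⟨y, hy0, hfy, hyK⟩ : ∃ y : C₀(Ω, ℝ), 0 ≤ y ∧ f y = 0 ∧ ∀ ω ∈ K, u ω ≤ y ω := by
    refine hK.induction_on (p := fun s => ∃ y : C₀(Ω, ℝ), 0 ≤ y ∧ f y = 0 ∧ ∀ ω ∈ s, u ω ≤ y ω)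
      ⟨0, le_rfl, map_zero f, by simp⟩ ?_ ?_ ?_
    · rintro s t hst ⟨y, h1, h2, h3⟩
      exact ⟨y, h1, h2, fun ω hω => h3 ω (hst hω)⟩
    · rintro s t ⟨y, h1, h2, h3⟩ ⟨z, k1, k2, k3⟩
      refine ⟨y + z, add_nonneg h1 k1, by rw [map_add, h2, k2, add_zero], ?_⟩
      rintro ω (hω | hω)
      · exact (h3 ω hω).trans (le_add_of_nonneg_right (k1 ω))
      · exact (k3 ω hω).trans (le_add_of_nonneg_left (h1 ω))
    · intro ω _
      obtain ⟨y, h1, h2, h3⟩ := hcon ω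
      have hpos : 0 < y ω := lt_of_le_of_ne (h1 ω) h3.symm
      obtain ⟨c, hc⟩ := exists_gt (u ω / y ω)
      have hc0 : 0 ≤ c := (div_nonneg (hu ω) hpos.le).trans hc.le
      have hlt : u ω < c * y ω := (div_lt_iff₀ hpos).1 hc
      refine ⟨{ω' | u ω' < c * y ω'}, mem_nhdsWithin_of_mem_nhds
        ((isOpen_lt u.continuous (continuous_const.mul y.continuous)).mem_nhds hlt),
        c • y, fun ω' => mul_nonneg hc0 (h1 ω'), by rw [map_smul, h2, smul_zero],
        fun ω' hω' => le_of_lt hω'⟩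
  have hle : 0 ≤ y + ε • sqrtFun u - u := by
    intro ω
    change 0 ≤ y ω + ε * √(u ω) - u ω
    have hs := Real.sqrt_nonneg (u ω)
    by_cases hω : ω ∈ K
    · have := hyK ω hω
      have := mul_nonneg hε.le hs
      linarith
    · have h1 : √(u ω) ≤ ε := (Real.sqrt_le_left hε.le).2 (le_of_lt (hKu hω))
      have h2 := Real.mul_self_sqrt (hu ω)
      have h3 : 0 ≤ y ω := hy0 ω
      nlinarith [mul_le_mul_of_nonneg_right h1 hs]
  have := hf _ hle
  rw [map_sub, map_add, map_smul, hfy, hfu, smul_eq_mul] at this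
  linarith

variable [LocallyCompactSpace Ω] [T2Space Ω]

theorem exists_C0_bump {K U : Set Ω} (hK : IsCompact K) (hU : IsOpen U) (hKU : K ⊆ U) :
    ∃ x : C₀(Ω, ℝ), (∀ ω ∈ K, x ω = 1) ∧ (∀ ω ∉ U, x ω = 0) ∧ ∀ ω, ‖x ω‖ ≤ 1 := by
  obtain ⟨f, h1, h0, hc, hI⟩ := exists_continuous_one_zero_of_isCompact hK hU.isClosed_compl
    (Set.disjoint_compl_right_iff_subset.2 hKU)
  refine ⟨⟨f, hc.is_zero_at_infty⟩, h1, h0, fun ω => ?_⟩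
  change ‖f ω‖ ≤ 1
  rw [Real.norm_of_nonneg (hI ω).1]
  exact (hI ω).2

theorem exists_C0_apply_eq_one (ω : Ω) : ∃ x : C₀(Ω, ℝ), x ω = 1 ∧ ∀ ω', ‖x ω'‖ ≤ 1 := by
  obtain ⟨x, h1, -, h⟩ := exists_C0_bump (isCompact_singleton (x := ω)) isOpen_univ
    (Set.subset_univ _)
  exact ⟨x, h1 ω rfl, h⟩

/-- Weighted point evaluations determine the point and the weight. -/
theorem weighted_eval_injective {c d : ℝ} {a b : Ω} (hc : c ≠ 0)
    (h : ∀ x : C₀(Ω, ℝ), c * x a = d * x b) : a = b ∧ c = d := by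
  have hab : a = b := by
    by_contra hab
    obtain ⟨x, h1, h0, -⟩ := exists_C0_bump (isCompact_singleton (x := a))
      (isOpen_compl_singleton (x := b)) (by simpa using Ne.symm hab)
    have := h x
    rw [h1 a rfl, h0 b (by simp)] at this
    exact hc (by simpa using this)
  subst hab
  obtain ⟨x, h1, -⟩ := exists_C0_apply_eq_one a
  refine ⟨rfl, ?_⟩
  simpa [h1] using h x

/-- The nonzero lattice homomorphisms `C₀(Ω) → ℝ` are the positive multiples of the point
evaluations. -/
theorem exists_eq_weighted_eval (f : C₀(Ω, ℝ) →ₗ[ℝ] ℝ) (hf : ∀ x y, f (x ⊔ y) = f x ⊔ f y)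
    (hne : f ≠ 0) : ∃ (c : ℝ) (ω : Ω), 0 < c ∧ ∀ x, f x = c * x ω := by
  have habs : ∀ x, f |x| = |f x| := fun x => by
    rw [abs, abs, hf, map_neg]
  have hpos : ∀ x, 0 ≤ x → 0 ≤ f x := fun x hx => by
    rw [← abs_of_nonneg hx, habs]
    exact abs_nonneg _
  obtain ⟨v, hv⟩ : ∃ v, f v ≠ 0 := by
    by_contra! h
    exact hne (LinearMap.ext h)
  have hv' : 0 < |f v| := abs_pos.2 hv
  obtain ⟨u, hu, hfu⟩ : ∃ u, 0 ≤ u ∧ f u = 1 :=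
    ⟨|f v|⁻¹ • |v|, fun ω => mul_nonneg (inv_nonneg.2 hv'.le) (abs_nonneg (v ω)), by
      rw [map_smul, habs, smul_eq_mul, inv_mul_cancel₀ hv'.ne']⟩
  obtain ⟨ω, hω⟩ := exists_common_zero f hpos hu hfu
  -- `x - f x • u` lies in the kernel of `f`, and so does its absolute value, as `f` is a lattice
  -- homomorphism; it therefore vanishes at the common zero `ω`.
  have key : ∀ x, x ω = f x * u ω := fun x => by
    have h0 : |x - f x • u| ω = 0 := hω _ (abs_nonneg _) (by
      rw [habs, map_sub, map_smul, hfu, smul_eq_mul, mul_one, sub_self, abs_zero])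
    have h1 : |x ω - f x * u ω| = 0 := h0
    exact sub_eq_zero.1 (abs_eq_zero.1 h1)
  obtain ⟨x, hx, -⟩ := exists_C0_apply_eq_one ω
  have hu0 : u ω ≠ 0 := fun h => by simpa [h, hx] using key x
  refine ⟨(u ω)⁻¹, ω, inv_pos.2 (lt_of_le_of_ne (hu ω) hu0.symm), fun x => ?_⟩
  rw [key x]
  field_simp

end Evaluation

/-! ### Lattice automorphisms as weighted composition operators -/

section Structure

variable {Ω : Type*} [TopologicalSpace Ω] [LocallyCompactSpace Ω] [T2Space Ω]

theorem exists_weight_point (T : latticeAut C₀(Ω, ℝ)) (ω : Ω) :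
    ∃ p : ℝ × Ω, 0 < p.1 ∧ ∀ x, T.1 x ω = p.1 * x p.2 := by
  obtain ⟨c, ω', hc, h⟩ := exists_eq_weighted_eval
    (f := { toFun := fun x => T.1 x ω
            map_add' := fun x y => by rw [map_add]; rfl
            map_smul' := fun c x => by rw [map_smul]; rfl })
    (fun x y => by
      change T.1 (x ⊔ y) ω = _
      rw [(T.2 x y).1]
      rfl)
    (fun h0 => by
      obtain ⟨x, hx, -⟩ := exists_C0_apply_eq_one ω
      have h1 : T.1 (T.1.symm x) ω = 0 := LinearMap.congr_fun h0 (T.1.symm x)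
      rw [LinearEquiv.apply_symm_apply, hx] at h1
      exact one_ne_zero h1)
  exact ⟨(c, ω'), hc, h⟩

/-- The weight `h` in the description `T x = h · (x ∘ τ)` of a lattice automorphism. -/
def weight (T : latticeAut C₀(Ω, ℝ)) (ω : Ω) : ℝ := (exists_weight_point T ω).choose.1

/-- The point map `τ` in the description `T x = h · (x ∘ τ)` of a lattice automorphism. -/
def pointMap (T : latticeAut C₀(Ω, ℝ)) (ω : Ω) : Ω := (exists_weight_point T ω).choose.2

theorem weight_pos (T : latticeAut C₀(Ω, ℝ)) (ω : Ω) : 0 < weight T ω :=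
  (exists_weight_point T ω).choose_spec.1

theorem latticeAut_apply (T : latticeAut C₀(Ω, ℝ)) (x : C₀(Ω, ℝ)) (ω : Ω) :
    T.1 x ω = weight T ω * x (pointMap T ω) :=
  (exists_weight_point T ω).choose_spec.2 x

theorem pointMap_weight_eq {T : latticeAut C₀(Ω, ℝ)} {ω ω' : Ω} {d : ℝ}
    (h : ∀ x, T.1 x ω = d * x ω') : pointMap T ω = ω' ∧ weight T ω = d :=
  weighted_eval_injective (weight_pos T ω).ne' fun x => by rw [← latticeAut_apply, h]

theorem mul_apply_eq (S T : latticeAut C₀(Ω, ℝ)) (x : C₀(Ω, ℝ)) (ω : Ω) :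
    (S * T).1 x ω
      = weight S ω * weight T (pointMap S ω) * x (pointMap T (pointMap S ω)) := by
  change S.1 (T.1 x) ω = _
  rw [latticeAut_apply, latticeAut_apply, mul_assoc]

theorem pointMap_mul (S T : latticeAut C₀(Ω, ℝ)) (ω : Ω) :
    pointMap (S * T) ω = pointMap T (pointMap S ω) :=
  (pointMap_weight_eq fun x => mul_apply_eq S T x ω).1

theorem weight_mul (S T : latticeAut C₀(Ω, ℝ)) (ω : Ω) :
    weight (S * T) ω = weight S ω * weight T (pointMap S ω) :=
  (pointMap_weight_eq fun x => mul_apply_eq S T x ω).2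

theorem pointMap_one (ω : Ω) : pointMap (1 : latticeAut C₀(Ω, ℝ)) ω = ω :=
  (pointMap_weight_eq (d := 1) fun x => (one_mul (x ω)).symm).1

theorem weight_one (ω : Ω) : weight (1 : latticeAut C₀(Ω, ℝ)) ω = 1 :=
  (pointMap_weight_eq (d := 1) fun x => (one_mul (x ω)).symm).2

/-- If `x` is supported in `U`, then `T x` can be nonzero only at points that `pointMap T` sends
into `U`; the nonvanishing set of `T x` is open. -/
theorem continuous_pointMap (T : latticeAut C₀(Ω, ℝ)) : Continuous (pointMap T) := by
  refine continuous_def.2 fun U hU => isOpen_iff_mem_nhds.2 fun ω hω => ?_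
  obtain ⟨x, h1, h0, -⟩ := exists_C0_bump (isCompact_singleton (x := pointMap T ω)) hU
    (Set.singleton_subset_iff.2 hω)
  have hne : T.1 x ω ≠ 0 := by
    rw [latticeAut_apply, h1 _ rfl, mul_one]
    exact (weight_pos T ω).ne'
  filter_upwards [ContinuousAt.eventually_ne (g := fun ω' => T.1 x ω')
    (T.1 x).continuous.continuousAt hne] with ω' hω'
  by_contra hU'
  exact hω' (by rw [latticeAut_apply, h0 _ hU', mul_zero])

/-- The homeomorphism `φ` in the description `T x = h · (x ∘ φ⁻¹)` of a lattice automorphism. -/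
def underlyingHomeo : latticeAut C₀(Ω, ℝ) →* (Ω ≃ₜ Ω) where
  toFun T :=
    { toFun := pointMap T⁻¹
      invFun := pointMap T
      left_inv := fun ω => by rw [← pointMap_mul, inv_mul_cancel, pointMap_one]
      right_inv := fun ω => by rw [← pointMap_mul, mul_inv_cancel, pointMap_one]
      continuous_toFun := continuous_pointMap _
      continuous_invFun := continuous_pointMap _ }
  map_one' := by
    ext ω
    change pointMap (1 : latticeAut C₀(Ω, ℝ))⁻¹ ω = ω
    rw [inv_one, pointMap_one]
  map_mul' S T := by
    ext ω
    change pointMap (S * T)⁻¹ ω = pointMap S⁻¹ (pointMap T⁻¹ ω)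
    rw [mul_inv_rev, pointMap_mul]

theorem underlyingHomeo_eq {T : latticeAut C₀(Ω, ℝ)} {φ : Ω ≃ₜ Ω} {h : Ω → ℝ}
    (hT : ∀ x ω, T.1 x ω = h ω * x (φ.symm ω)) : underlyingHomeo T = φ := by
  have : (underlyingHomeo T).symm = φ.symm :=
    Homeomorph.ext fun ω => (pointMap_weight_eq fun x => hT x ω).1
  simpa using congrArg Homeomorph.symm this

theorem underlyingHomeo_homeoAut (φ : Ω ≃ₜ Ω) : underlyingHomeo (homeoAut φ) = φ :=
  underlyingHomeo_eq (h := 1) fun x ω => (one_mul (x (φ.symm ω))).symm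

theorem underlyingHomeo_mulAut (m : CbPos Ω) : underlyingHomeo (mulAut m) = 1 :=
  underlyingHomeo_eq (h := m.1) fun _ _ => rfl

theorem underlyingHomeo_conj (m : CbPos Ω) (φ : Ω ≃ₜ Ω) :
    underlyingHomeo (mulAut m * homeoAut φ * (mulAut m)⁻¹) = φ := by
  rw [map_mul, map_mul, map_inv, underlyingHomeo_mulAut, underlyingHomeo_homeoAut]
  simp

/-- Closed graph theorem: by the weighted evaluation formula, convergence of `u n` forces pointwise
convergence of `T (u n)`, which identifies the limit. -/
theorem continuous_latticeAut (T : latticeAut C₀(Ω, ℝ)) :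
    Continuous (T.1 : C₀(Ω, ℝ) → C₀(Ω, ℝ)) := by
  refine LinearMap.continuous_of_seq_closed_graph (g := (T.1 : C₀(Ω, ℝ) →ₗ[ℝ] C₀(Ω, ℝ)))
    fun u x y hu hTu => ?_
  have hev : ∀ ω : Ω, Continuous fun z : C₀(Ω, ℝ) => z ω := fun ω =>
    C0_continuous_eval.comp (continuous_id.prodMk continuous_const)
  ext ω
  refine tendsto_nhds_unique (((hev ω).tendsto y).comp hTu) ?_
  change Tendsto (fun n => T.1 (u n) ω) atTop (𝓝 (T.1 x ω))
  simp only [latticeAut_apply]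
  exact (((hev (pointMap T ω)).tendsto x).comp hu).const_mul _

end Structure

/-! ### Conjugation and order equivalence -/

section Conjugation

variable {E : Type*} [NormedAddCommGroup E] [NormedSpace ℝ E] [Lattice E] {G : Type*} [Group G]

theorem eq_inv_conj {ρ θ : G →* latticeAut E} {A : latticeAut E}
    (h : ∀ s, ρ s = A * θ s * A⁻¹) (s : G) : θ s = A⁻¹ * ρ s * A⁻¹⁻¹ := by
  rw [h s]
  group

/-- Order equivalence does not change under conjugation of the two representations. -/
theorem OrderEquivalent.of_conj {ρ₁ ρ₂ θ₁ θ₂ : G →* latticeAut E}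
    (h : OrderEquivalent θ₁ θ₂) {A B : latticeAut E} (h₁ : ∀ s, ρ₁ s = A * θ₁ s * A⁻¹)
    (h₂ : ∀ s, ρ₂ s = B * θ₂ s * B⁻¹) : OrderEquivalent ρ₁ ρ₂ := by
  obtain ⟨T, hT⟩ := h
  refine ⟨B * T * A⁻¹, fun s => ?_⟩
  calc B * T * A⁻¹ * ρ₁ s = B * (T * θ₁ s) * A⁻¹ := by rw [h₁]; group
    _ = ρ₂ s * (B * T * A⁻¹) := by rw [hT, h₂]; group

end Conjugation

/-! ### Compact images and the strong operator topology -/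

section Topology

theorem continuous_latticeAut_eval {E : Type*} [NormedAddCommGroup E] [NormedSpace ℝ E]
    [Lattice E] (x : E) :
    Continuous fun T : latticeAut E => T.1 x :=
  (continuous_apply x).comp continuous_induced_dom

variable {Ω : Type*} [TopologicalSpace Ω] [LocallyCompactSpace Ω] [T2Space Ω]

theorem continuous_mul_mul (A B : latticeAut C₀(Ω, ℝ)) :
    Continuous fun T : latticeAut C₀(Ω, ℝ) => A * T * B :=
  continuous_induced_rng.2 <| continuous_pi fun x =>
    (continuous_latticeAut A).comp (continuous_latticeAut_eval (B.1 x))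

/-- Near a given `(T, ω)` the point map stays in a fixed compact set `K`, as detected by a bump
function `y` supported in `K`. If `x = 1` on `K`, the weight there equals `T x ω`, which is jointly
continuous. -/
theorem continuous_weight :
    Continuous fun p : latticeAut C₀(Ω, ℝ) × Ω => weight p.1 p.2 := by
  have hev : ∀ x : C₀(Ω, ℝ), Continuous fun p : latticeAut C₀(Ω, ℝ) × Ω => p.1.1 x p.2 :=
    fun x => C0_continuous_eval.comp
      (((continuous_latticeAut_eval x).comp continuous_fst).prodMk continuous_snd)
  refine continuous_iff_continuousAt.2 fun ⟨T, ω⟩ => ?_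
  obtain ⟨K, hK, hmem⟩ := exists_compact_mem_nhds (pointMap T ω)
  obtain ⟨x, hx, -⟩ := exists_C0_bump hK isOpen_univ (Set.subset_univ _)
  obtain ⟨y, h1, h0, -⟩ := exists_C0_bump (isCompact_singleton (x := pointMap T ω))
    isOpen_interior (Set.singleton_subset_iff.2 (mem_interior_iff_mem_nhds.2 hmem))
  have hne : T.1 y ω ≠ 0 := by
    rw [latticeAut_apply, h1 _ rfl, mul_one]
    exact (weight_pos T ω).ne'
  refine (hev x).continuousAt.congr ?_
  filter_upwards [(hev y).continuousAt.eventually_ne (x := (T, ω)) hne] with p hp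
  have hpK : pointMap p.1 p.2 ∈ interior K := by
    by_contra hpK
    exact hp (by rw [latticeAut_apply, h0 _ hpK, mul_zero])
  rw [latticeAut_apply, hx _ (interior_subset hpK), mul_one]

/-- Orbits of a compact set are norm bounded, so Banach–Steinhaus bounds the operator norms, and
each weight is at most the norm of its operator. -/
theorem exists_weight_le {S : Set (latticeAut C₀(Ω, ℝ))} (hS : IsCompact S) :
    ∃ C, ∀ T ∈ S, ∀ ω, weight T ω ≤ C := by
  obtain ⟨C, hC⟩ := banach_steinhaus
    (g := fun T : S => (⟨(T.1.1 : C₀(Ω, ℝ) →ₗ[ℝ] C₀(Ω, ℝ)), continuous_latticeAut T.1⟩ :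
      C₀(Ω, ℝ) →L[ℝ] C₀(Ω, ℝ)))
    (fun x => by
      obtain ⟨C, hC⟩ := (hS.image (continuous_latticeAut_eval x)).isBounded.exists_norm_le
      exact ⟨C, fun T => hC _ ⟨T.1, T.2, rfl⟩⟩)
  refine ⟨C, fun T hT ω => ?_⟩
  obtain ⟨x, hx, hx1⟩ := exists_C0_apply_eq_one (pointMap T ω)
  have hC0 : 0 ≤ C := (norm_nonneg _).trans (hC ⟨T, hT⟩)
  calc weight T ω = T.1 x ω := by rw [latticeAut_apply, hx, mul_one]
    _ ≤ ‖T.1 x‖ := (Real.le_norm_self _).trans (C0_norm_apply_le _ _)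
    _ ≤ C * ‖x‖ := ContinuousLinearMap.le_of_opNorm_le _ (hC ⟨T, hT⟩) x
    _ ≤ C := mul_le_of_le_one_right hC0 (C0_norm_le zero_le_one hx1)

variable {G : Type*} [Group G]

/-- A positive representation with compact image is conjugate, by a multiplication operator,
to the representation given by its underlying homeomorphisms. -/
theorem exists_eq_conj (ρ : G →* latticeAut C₀(Ω, ℝ)) (hρ : HasCompactImage ρ) :
    ∃ m : CbPos Ω, ∀ s,
      ρ s = mulAut m * homeoRep (underlyingHomeo.comp ρ) s * (mulAut m)⁻¹ := by
  obtain ⟨C, hC⟩ := exists_weight_le hρ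
  have hbdd : ∀ ω, BddAbove (range fun s => weight (ρ s) ω) := fun ω =>
    ⟨C, by rintro _ ⟨s, rfl⟩; exact hC _ ⟨s, rfl⟩ ω⟩
  have hle : ∀ ω s, weight (ρ s) ω ≤ ⨆ t, weight (ρ t) ω := fun ω s => le_ciSup (hbdd ω) s
  have hone : ∀ ω, 1 ≤ ⨆ t, weight (ρ t) ω := fun ω => by
    simpa [weight_one] using hle ω 1
  have hcont : Continuous fun ω => ⨆ t, weight (ρ t) ω := by
    -- A supremum of a jointly continuous function over a compact parameter set, here the range of
    -- `ρ`, is continuous.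
    have := hρ.continuous_sSup (f := fun ω T => weight T ω)
      (continuous_weight.comp (continuous_snd.prodMk continuous_fst))
    simp only [← range_comp] at this
    exact this
  let m : CbPos Ω := ⟨BoundedContinuousFunction.ofNormedAddCommGroup
    (fun ω => ⨆ t, weight (ρ t) ω) hcont C (fun ω => by
      rw [Real.norm_of_nonneg (zero_le_one.trans (hone ω))]
      exact ciSup_le fun s => hC _ ⟨s, rfl⟩ ω), 1, one_pos, hone⟩
  -- By the cocycle identity, the right-hand side is the supremum of the weights of `ρ (s * t)` over
  -- `t`; left translation by `s` permutes `G`.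
  have hm : ∀ s ω, m.1 ω = weight (ρ s) ω * m.1 (pointMap (ρ s) ω) := fun s ω => by
    change ⨆ t, weight (ρ t) ω = weight (ρ s) ω * ⨆ t, weight (ρ t) (pointMap (ρ s) ω)
    rw [Real.mul_iSup_of_nonneg (weight_pos _ _).le]
    simp_rw [← weight_mul, ← map_mul]
    exact ((Equiv.mulLeft s).iSup_comp (g := fun t => weight (ρ t) ω)).symm
  refine ⟨m, fun s => eq_mul_inv_of_mul_eq (Subtype.ext (LinearEquiv.ext fun x => ?_))⟩
  ext ω
  change (ρ s).1 (mulFun m.1 x) ω = m.1 ω * x (pointMap (ρ s) ω)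
  rw [latticeAut_apply, hm s ω, mul_assoc]
  rfl

theorem eq_underlyingHomeo_comp {ρ : G →* latticeAut C₀(Ω, ℝ)} {π : G →* (Ω ≃ₜ Ω)} {m : CbPos Ω}
    (h : ∀ s, ρ s = mulAut m * homeoRep π s * (mulAut m)⁻¹) : π = underlyingHomeo.comp ρ := by
  ext1 s
  rw [MonoidHom.comp_apply, h s]
  exact (underlyingHomeo_conj m (π s)).symm

theorem HasCompactImage.of_conj {ρ θ : G →* latticeAut C₀(Ω, ℝ)} (hθ : HasCompactImage θ)
    {A : latticeAut C₀(Ω, ℝ)} (h : ∀ s, ρ s = A * θ s * A⁻¹) : HasCompactImage ρ := by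
  have := IsCompact.image hθ (continuous_mul_mul A A⁻¹)
  rwa [← range_comp, show (fun T => A * T * A⁻¹) ∘ θ = ρ from funext fun s => (h s).symm] at this

theorem continuous_of_conj [TopologicalSpace G] {ρ θ : G →* latticeAut C₀(Ω, ℝ)}
    (hθ : Continuous θ) {A : latticeAut C₀(Ω, ℝ)} (h : ∀ s, ρ s = A * θ s * A⁻¹) :
    Continuous ρ := by
  have := (continuous_mul_mul A A⁻¹).comp hθ
  rwa [show (fun T => A * T * A⁻¹) ∘ θ = ρ from funext fun s => (h s).symm] at this

/-- Order equivalent representations by homeomorphisms are isometrically order equivalent. -/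
theorem OrderEquivalent.isometricallyOrderEquivalent {π₁ π₂ : G →* (Ω ≃ₜ Ω)}
    (h : OrderEquivalent (homeoRep π₁) (homeoRep π₂)) :
    IsometricallyOrderEquivalent (homeoRep π₁) (homeoRep π₂) := by
  obtain ⟨T, hT⟩ := h
  -- Discarding the weight of `T` keeps the intertwining relation, since `underlyingHomeo` is a
  -- homomorphism that recovers `π₁` and `π₂`.
  refine ⟨homeoAut (underlyingHomeo T), homeoAut_isometric _, fun s => ?_⟩
  have := congrArg underlyingHomeo (hT s)
  rw [map_mul, map_mul, homeoRep, homeoRep, MonoidHom.comp_apply, MonoidHom.comp_apply,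
    underlyingHomeo_homeoAut, underlyingHomeo_homeoAut] at this
  rw [homeoRep, homeoRep, MonoidHom.comp_apply, MonoidHom.comp_apply, ← map_mul, this, map_mul]

end Topology

end

end PosRep

theorem theoremt {Ω : Type*} [TopologicalSpace Ω] [LocallyCompactSpace Ω] [T2Space Ω]
    {G : Type*} [Group G] :
    -- existence, uniqueness of `π`, and compactness of its image
    (∀ ρ : G →* latticeAut C₀(Ω, ℝ), HasCompactImage ρ →
      (∃! π : G →* (Ω ≃ₜ Ω), ∃ m : CbPos Ω,
        ∀ s, ρ s = mulAut m * homeoRep π s * (mulAut m)⁻¹) ∧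
      ∀ (π : G →* (Ω ≃ₜ Ω)) (m : CbPos Ω),
        (∀ s, ρ s = mulAut m * homeoRep π s * (mulAut m)⁻¹) → HasCompactImage (homeoRep π)) ∧
    -- the converse
    (∀ (π : G →* (Ω ≃ₜ Ω)) (m : CbPos Ω), HasCompactImage (homeoRep π) →
      ∃ ρ : G →* latticeAut C₀(Ω, ℝ),
        (∀ s, ρ s = mulAut m * homeoRep π s * (mulAut m)⁻¹) ∧ HasCompactImage ρ) ∧
    -- strong continuity
    (∀ [TopologicalSpace G] (ρ : G →* latticeAut C₀(Ω, ℝ)) (π : G →* (Ω ≃ₜ Ω)) (m : CbPos Ω),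
      HasCompactImage ρ → (∀ s, ρ s = mulAut m * homeoRep π s * (mulAut m)⁻¹) →
      (Continuous ρ ↔ Continuous (homeoRep π))) ∧
    -- order equivalence
    (∀ (ρ₁ ρ₂ : G →* latticeAut C₀(Ω, ℝ)) (π₁ π₂ : G →* (Ω ≃ₜ Ω)) (m₁ m₂ : CbPos Ω),
      HasCompactImage ρ₁ → HasCompactImage ρ₂ →
      HasCompactImage (homeoRep π₁) → HasCompactImage (homeoRep π₂) →
      (∀ s, ρ₁ s = mulAut m₁ * homeoRep π₁ s * (mulAut m₁)⁻¹) →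
      (∀ s, ρ₂ s = mulAut m₂ * homeoRep π₂ s * (mulAut m₂)⁻¹) →
      (OrderEquivalent ρ₁ ρ₂ ↔
        IsometricallyOrderEquivalent (homeoRep π₁) (homeoRep π₂))) := by
  refine ⟨fun ρ hρ => ⟨?_, fun π m h => hρ.of_conj (eq_inv_conj h)⟩, fun π m hπ => ?_,
    fun ρ π m _ h => ⟨fun hc => continuous_of_conj hc (eq_inv_conj h),
      fun hc => continuous_of_conj hc h⟩,
    fun ρ₁ ρ₂ π₁ π₂ m₁ m₂ _ _ _ _ h₁ h₂ => ⟨fun h => ?_, fun ⟨T, _, hT⟩ => ?_⟩⟩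
  · exact ⟨underlyingHomeo.comp ρ, exists_eq_conj ρ hρ,
      fun π ⟨m, h⟩ => eq_underlyingHomeo_comp h⟩
  · have h : ∀ s, (MulAut.conj (mulAut m)).toMonoidHom.comp (homeoRep π) s
        = mulAut m * homeoRep π s * (mulAut m)⁻¹ := fun s => rfl
    exact ⟨_, h, hπ.of_conj h⟩
  · exact (h.of_conj (eq_inv_conj h₁) (eq_inv_conj h₂)).isometricallyOrderEquivalent
  · exact OrderEquivalent.of_conj ⟨T, hT⟩ h₁ h₂
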